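/- Let $F_n$ be the free group on $a_1,\dots,a_n$, let $\Pi A(F_n)\le \mathrm{Aut}(F_n)$ be the subgroup of automorphisms $\alpha$ for which the reduced word of every $\alpha(a_i)$ is a palindrome, and let $\sigma_n\in\Pi A(F_n)$ be given by $\sigma_n(a_i)=a_i^{-1}$ for all $i$. Let $A$ be a finite subgroup of $\Pi A(F_n)$ with $\sigma_n\in A$. Let $\Gamma$ be a finite connected graph with basepoint $*$, together with a marking, that is, a basepoint-preserving homotopy equivalence $\phi\colon R_n\to\Gamma$ from the $n$-petal rose, taken up to pointed homotopy (equivalently, an isomorphism $\phi_*\colon F_n\to\pi_1(\Gamma,*)$). Suppose that $A$ acts on $\Gamma$ by basepoint-preserving graph automorphisms, without inversions (no edge is sent to its inverse), that this action realizes $A$ (the automorphism by which $a\in A$ acts on $\Gamma$ induces $\phi_*\,a\,\phi_*^{-1}$ on $\pi_1(\Gamma,*)$), and that it is $A$-reduced, i.e. $\Gamma$ has no $A$-invariant subforest with at least one edge. Then the marked graph $\phi\colon R_n\to\Gamma$ is also $\langle\sigma_n\rangle$-reduced: $\Gamma$ has no $\langle\sigma_n\rangle$-invariant subforest with at least one edge.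 Consequently $\Gamma$ is a $\theta_1$-tree of rank $n$, on which $\sigma_n$ acts by the natural involution: there is a tree $T$ with $n$ edges, with the same vertex set and basepoint as $\Gamma$, such that $\Gamma$ is obtained from $T$ by replacing every edge by two parallel edges with the same endpoints, and $\sigma_n$ fixes every vertex and interchanges the two edges of each such pair. -/

import Mathlib

/-! Palindromic automorphisms of free groups -/

/-- The automorphism `σ_n` of `F_n` which inverts every generator `a_i`. -/
def sigma (n : ℕ) : MulAut (FreeGroup (Fin n)) :=
  MonoidHom.toMulEquiv
    (FreeGroup.lift fun i : Fin n => (FreeGroup.of i)⁻¹)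
    (FreeGroup.lift fun i : Fin n => (FreeGroup.of i)⁻¹)
    (by ext i; simp) (by ext i; simp)

/-- An element of a free group is a palindrome if its reduced word equals its reverse. -/
def IsPalindromic {n : ℕ} (w : FreeGroup (Fin n)) : Prop :=
  w.toWord.reverse = w.toWord

theorem sigma_of (n : ℕ) (i : Fin n) : sigma n (FreeGroup.of i) = (FreeGroup.of i)⁻¹ := by
  simp [sigma]

theorem sigma_mk (n : ℕ) (L : List (Fin n × Bool)) :
    sigma n (FreeGroup.mk L) = (FreeGroup.mk L.reverse)⁻¹ := by
  induction L with
  | nil => simp [← FreeGroup.one_eq_mk]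
  | cons x L ih =>
    have h1 : FreeGroup.mk (x :: L) = FreeGroup.mk [x] * FreeGroup.mk L := by
      simp [FreeGroup.mul_mk]
    have h2 : FreeGroup.mk (x :: L).reverse = FreeGroup.mk L.reverse * FreeGroup.mk [x] := by
      simp [FreeGroup.mul_mk]
    have h3 : sigma n (FreeGroup.mk [x]) = (FreeGroup.mk [x])⁻¹ := by
      obtain ⟨i, b⟩ := x
      cases b
      · have : FreeGroup.mk [(i, false)] = (FreeGroup.of i)⁻¹ := by
          simp [FreeGroup.of, FreeGroup.inv_mk, FreeGroup.invRev]
        rw [this, map_inv, sigma_of]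
      · exact sigma_of n i
    rw [h1, h2, map_mul, ih, h3, mul_inv_rev]

theorem isPalindromic_iff {n : ℕ} (w : FreeGroup (Fin n)) :
    IsPalindromic w ↔ sigma n w = w⁻¹ := by
  have key : sigma n w = (FreeGroup.mk w.toWord.reverse)⁻¹ := by
    conv_lhs => rw [← FreeGroup.mk_toWord (x := w)]
    exact sigma_mk n _
  rw [key, inv_inj]
  constructor
  · intro h
    rw [h, FreeGroup.mk_toWord]
  · intro h
    have hr : FreeGroup.IsReduced w.toWord.reverse := by
      have h0 : FreeGroup.IsReduced w.toWord := FreeGroup.isReduced_toWord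
      rw [FreeGroup.IsReduced, List.isChain_reverse]
      exact h0.imp fun a b hab hba => (hab hba.symm).symm
    have h1 := congrArg FreeGroup.toWord h
    rwa [FreeGroup.toWord_mk, hr.reduce_eq] at h1

theorem palindromic_iff_commute {n : ℕ} (α : MulAut (FreeGroup (Fin n))) :
    (∀ i, IsPalindromic (α (FreeGroup.of i))) ↔ sigma n * α = α * sigma n := by
  constructor
  · intro h
    have : (sigma n * α).toMonoidHom = (α * sigma n).toMonoidHom := by
      ext i
      have hi := (isPalindromic_iff _).1 (h i)
      simp [hi, sigma_of]
    exact MulEquiv.toMonoidHom_injective this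
  · intro h i
    rw [isPalindromic_iff]
    have := congrArg (fun β : MulAut (FreeGroup (Fin n)) => β (FreeGroup.of i)) h
    simpa [sigma_of] using this

/-- The palindromic automorphism group `ΠA(F_n)`: all automorphisms `α` of `F_n` for which every
`α(a_i)` is a palindrome. -/
def palindromicAut (n : ℕ) : Subgroup (MulAut (FreeGroup (Fin n))) where
  carrier := {α | ∀ i, IsPalindromic (α (FreeGroup.of i))}
  one_mem' := (palindromic_iff_commute 1).2 (by simp)
  mul_mem' {α β} ha hb := by
    have ha : Commute (sigma n) α := (palindromic_iff_commute α).1 ha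
    have hb : Commute (sigma n) β := (palindromic_iff_commute β).1 hb
    exact (palindromic_iff_commute (α * β)).2 (ha.mul_right hb)
  inv_mem' {α} ha := by
    have ha : Commute (sigma n) α := (palindromic_iff_commute α).1 ha
    exact (palindromic_iff_commute α⁻¹).2 ha.inv_right

/-! Pointed graphs and their fundamental groups -/

/-- A pointed graph with vertex set `V` and set `E` of oriented edges: every oriented edge `e` has
an initial vertex `src e` and an inverse edge `bar e ≠ e`; the geometric edges are the pairs
`{e, bar e}`. Loops and multiple edges are allowed. -/
structure PointedGraph (V E : Type*) where
  src : E → V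
  bar : E → E
  bar_bar : ∀ e, bar (bar e) = e
  bar_ne : ∀ e, bar e ≠ e
  base : V

namespace PointedGraph

section

variable {V E : Type*} (Γ : PointedGraph V E)

/-- The terminal vertex of an oriented edge. -/
def tgt (e : E) : V := Γ.src (Γ.bar e)

/-- `Γ.IsPath v l w`: the list `l` of oriented edges is an edge path from `v` to `w`. -/
def IsPath : V → List E → V → Prop
  | v, [], w => v = w
  | v, e :: l, w => Γ.src e = v ∧ IsPath (Γ.tgt e) l w

/-- The graph is connected: every vertex is joined to the basepoint by an edge path. -/
def Connected : Prop := ∀ v, ∃ l, Γ.IsPath Γ.base l v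

/-- An edge path is reduced (taut) if it has no backtracking `e, bar e`. -/
def IsTaut (l : List E) : Prop := l.IsChain fun e f => f ≠ Γ.bar e

/-- A set of oriented edges spans a forest if it contains no circuit, that is, no nonempty closed
edge path without backtracking. -/
def IsForest (S : Set E) : Prop :=
  ∀ (v : V) (l : List E), (∀ e ∈ l, e ∈ S) → Γ.IsPath v l v → Γ.IsTaut l → l = []

variable {Γ}

theorem tgt_bar (e : E) : Γ.tgt (Γ.bar e) = Γ.src e := by
  simp [tgt, Γ.bar_bar]

theorem IsPath.append {u v w : V} {l m : List E} (h : Γ.IsPath u l v) (h' : Γ.IsPath v m w) :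
    Γ.IsPath u (l ++ m) w := by
  induction l generalizing u with
  | nil => cases h; exact h'
  | cons e l ih => exact ⟨h.1, ih h.2⟩

variable (Γ) in
/-- The edge list of the reversed path. -/
def revPath (l : List E) : List E := (l.map Γ.bar).reverse

theorem revPath_cons (e : E) (l : List E) : Γ.revPath (e :: l) = Γ.revPath l ++ [Γ.bar e] := by
  simp [revPath]

theorem revPath_append (l m : List E) : Γ.revPath (l ++ m) = Γ.revPath m ++ Γ.revPath l := by
  simp [revPath]

theorem IsPath.rev {u v : V} {l : List E} (h : Γ.IsPath u l v) :
    Γ.IsPath v (Γ.revPath l) u := by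
  induction l generalizing u with
  | nil => exact Eq.symm h
  | cons e l ih =>
    rw [revPath_cons]
    exact (ih h.2).append ⟨rfl, (tgt_bar e).trans h.1⟩

variable (Γ) in
/-- Closed edge paths at the basepoint. -/
def ClosedPath : Type _ := {l : List E // Γ.IsPath Γ.base l Γ.base}

variable (Γ) in
/-- An elementary homotopy of closed edge paths: deletion of a backtracking `e, bar e`. -/
def Step (p q : Γ.ClosedPath) : Prop :=
  ∃ (l m : List E) (e : E), p.1 = l ++ e :: Γ.bar e :: m ∧ q.1 = l ++ m

variable (Γ) in
/-- The fundamental group `π₁(Γ, *)`: closed edge paths at the basepoint modulo the equivalence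
relation generated by elementary homotopies. -/
def Pi1 : Type _ := Quot Γ.Step

/-- The homotopy class of a closed edge path. -/
def Pi1.mk (p : Γ.ClosedPath) : Γ.Pi1 := Quot.mk _ p

theorem Pi1.rev_mul_self {v w : V} (l : List E) (h : Γ.IsPath v l w) (hw : w = Γ.base) :
    Pi1.mk (Γ := Γ) ⟨Γ.revPath l ++ l, by subst hw; exact h.rev.append h⟩ =
      Pi1.mk ⟨[], rfl⟩ := by
  induction l generalizing v with
  | nil => rfl
  | cons e l ih =>
    rw [← ih h.2]
    refine Quot.sound ⟨Γ.revPath l, l, Γ.bar e, ?_, rfl⟩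
    simp [revPath_cons, Γ.bar_bar]

/-- The group structure: concatenation of closed paths, inverted by reversing paths. -/
instance : Group Γ.Pi1 where
  mul := Quot.map₂ (fun p q => ⟨p.1 ++ q.1, p.2.append q.2⟩)
    (by
      rintro p q q' ⟨l, m, e, h, h'⟩
      exact ⟨p.1 ++ l, m, e, by simp [h], by simp [h']⟩)
    (by
      rintro p p' q ⟨l, m, e, h, h'⟩
      exact ⟨l, m ++ q.1, e, by simp [h], by simp [h']⟩)
  one := Pi1.mk ⟨[], rfl⟩
  inv := Quot.map (fun p => ⟨Γ.revPath p.1, p.2.rev⟩)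
    (by
      rintro p p' ⟨l, m, e, h, h'⟩
      refine ⟨Γ.revPath m, Γ.revPath l, Γ.bar (Γ.bar e), ?_, ?_⟩
      · simp [h, revPath_append, revPath_cons, Γ.bar_bar]
      · simp [h', revPath_append])
  mul_assoc := by
    rintro ⟨a⟩ ⟨b⟩ ⟨c⟩
    exact congrArg Pi1.mk (Subtype.ext (List.append_assoc _ _ _))
  one_mul := by
    rintro ⟨a⟩
    rfl
  mul_one := by
    rintro ⟨a⟩
    exact congrArg Pi1.mk (Subtype.ext (List.append_nil _))
  inv_mul_cancel := by
    rintro ⟨a⟩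
    exact Pi1.rev_mul_self a.1 a.2 rfl

theorem Pi1.mk_mul_mk (p q : Γ.ClosedPath) :
    Pi1.mk p * Pi1.mk q = Pi1.mk ⟨p.1 ++ q.1, p.2.append q.2⟩ := rfl

variable (Γ) in
/-- An action of a group `G` on the pointed graph `Γ` by basepoint-preserving graph
automorphisms. -/
structure Action (G : Type*) [Group G] where
  onV : G →* Equiv.Perm V
  onE : G →* Equiv.Perm E
  src_onE : ∀ g e, Γ.src (onE g e) = onV g (Γ.src e)
  bar_onE : ∀ g e, Γ.bar (onE g e) = onE g (Γ.bar e)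
  base_onV : ∀ g, onV g Γ.base = Γ.base

namespace Action

variable {G : Type*} [Group G] (ρ : Γ.Action G)

/-- The action is without inversions: no edge is sent to its inverse. -/
def WithoutInversions : Prop := ∀ g e, ρ.onE g e ≠ Γ.bar e

/-- The action is reduced: there is no `G`-invariant subforest with at least one edge. -/
def IsReduced : Prop :=
  ∀ S : Set E, S.Nonempty → (∀ e ∈ S, Γ.bar e ∈ S) → (∀ g, ∀ e ∈ S, ρ.onE g e ∈ S) →
    ¬ Γ.IsForest S

/-- The restriction of an action to a subgroup. -/
def restrict (H : Subgroup G) : Γ.Action H where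
  onV := ρ.onV.comp H.subtype
  onE := ρ.onE.comp H.subtype
  src_onE g e := ρ.src_onE g e
  bar_onE g e := ρ.bar_onE g e
  base_onV g := ρ.base_onV g

theorem isPath_map (g : G) {v w : V} {l : List E} (h : Γ.IsPath v l w) :
    Γ.IsPath (ρ.onV g v) (l.map (ρ.onE g)) (ρ.onV g w) := by
  induction l generalizing v with
  | nil => exact congrArg (ρ.onV g) h
  | cons e l ih =>
    refine ⟨(ρ.src_onE g e).trans (congrArg (ρ.onV g) h.1), ?_⟩
    have := ih h.2
    rwa [tgt, ← ρ.src_onE, ← ρ.bar_onE] at this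

/-- The endomorphism of `π₁(Γ, *)` induced by the automorphism of `Γ` by which `g` acts. -/
def onPi1 (g : G) : Γ.Pi1 →* Γ.Pi1 where
  toFun := Quot.map
    (fun p => ⟨p.1.map (ρ.onE g), by
      have := ρ.isPath_map g p.2
      rwa [ρ.base_onV] at this⟩)
    (by
      rintro p p' ⟨l, m, e, h, h'⟩
      refine ⟨l.map (ρ.onE g), m.map (ρ.onE g), ρ.onE g e, ?_, ?_⟩
      · simp [h, ρ.bar_onE]
      · simp [h'])
  map_one' := rfl
  map_mul' := by
    rintro ⟨a⟩ ⟨b⟩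
    exact congrArg Pi1.mk (Subtype.ext List.map_append)

end Action

variable (Γ) in
/-- Let `A` be a group of automorphisms of `F_n` and let `φ` be the isomorphism from
`F_n = π₁(R_n, *)` to `π₁(Γ, *)` induced by a pointed marking `R_n → Γ`. The action `ρ` of `A` on `Γ`
realizes `A` on this marked graph if, for each `a ∈ A`, the map induced by `ρ a` on `π₁(Γ, *)`
corresponds to `a` under `φ`. -/
def Realizes {n : ℕ} (A : Subgroup (MulAut (FreeGroup (Fin n))))
    (φ : FreeGroup (Fin n) ≃* Γ.Pi1) (ρ : Γ.Action A) : Prop :=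
  ∀ (a : A) (w : FreeGroup (Fin n)), ρ.onPi1 a (φ w) = φ ((a : MulAut (FreeGroup (Fin n))) w)

variable (Γ) in
/-- The structure of a `θ_1`-tree of rank `n` on the graph `Γ`: a tree `T` with `n` edges on the
vertex set of `Γ` (pointed by the basepoint of `Γ`), and an identification of `Γ` with the graph
obtained by doubling each edge of `T`. The oriented edges of the double are the pairs of an
oriented edge of `T` and a label in `Bool` telling which of the two copies is meant. -/
structure ThetaOneTree (n : ℕ) where
  T : SimpleGraph V
  isTree : T.IsTree
  card_edges : T.edgeSet.ncard = n
  double : E ≃ T.Dart × Bool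
  src_double : ∀ e, Γ.src e = (double e).1.fst
  bar_double : ∀ e, double (Γ.bar e) = ((double e).1.symm, (double e).2)

/-- The natural involution of a `θ_1`-tree: it fixes the vertices, and this is its effect on the
oriented edges, switching the two copies of each edge of the tree. -/
def ThetaOneTree.switch {n : ℕ} (D : Γ.ThetaOneTree n) (e : E) : E :=
  D.double.symm ((D.double e).1, !(D.double e).2)

end

end PointedGraph

/-!
Let `s` be the automorphism of `Γ` by which `σ_n` acts. As `σ_n` inverts the generators of `F_n`,
it acts by `-1` on `Hom(F_n, M)` for every abelian group `M`; so `s` is a hyperelliptic involution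
of `Γ`, one that acts by `-1` on homology (`isHyperelliptic_sigma`). By `palindromic_iff_commute`
it commutes with the action of `A`. Homology is handled through its dual: cochains on `Γ` summed
along edge paths. An `s`-invariant integral cochain sums to zero along every closed path
(`sum_eq_zero`); in other words, the quotient of `Γ` by `s` is a tree.

Two `A`-invariant forests carry the argument. The edges fixed by `s` form a forest
(`isForest_fixed`), so as the action is reduced, `s` fixes no edge. The quotient itself is not
constructed; its tree structure is expressed on `Γ` by the distance from the basepoint: an edge
changes the distance, and two different edges through which the same vertex is reached from the
basepoint are interchanged by `s` (`depth_src_ne_depth_tgt`, `eq_or_eq_onE`). If such a vertex is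
moved by `s`, there is just one edge through which it is reached. Hence the edges whose
endpoint farther from the basepoint is moved form a forest (`isForest_movedEdges`), and this must
again be empty: `s` fixes all vertices.

So `s` interchanges the two edges through which each vertex other than the basepoint is reached,
and these two have the same endpoints. In particular `⟨s⟩` has no invariant forest, and collapsing
the pairs gives a tree with one edge for each vertex other than the basepoint
(`card_edgeSet_simple`, `exists_thetaOneTree`). That their number is `n` follows by counting
homomorphisms to `ℤ/3`: classes in `H¹(Γ; 𝔽₃)` are uniquely represented by cochains negated by
`s`, and these have one free value for each pair (`card_hom_pi1`).
-/

namespace PointedGraph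

variable {V E : Type*} {Γ : PointedGraph V E}

/-! ### Paths, forests and cochains -/

theorem isPath_append {u w : V} {l m : List E} :
    Γ.IsPath u (l ++ m) w ↔ ∃ v, Γ.IsPath u l v ∧ Γ.IsPath v m w := by
  constructor
  · intro h
    induction l generalizing u with
    | nil => exact ⟨u, rfl, h⟩
    | cons e l ih =>
      obtain ⟨v, hl, hm⟩ := ih h.2
      exact ⟨v, ⟨h.1, hl⟩, hm⟩
  · rintro ⟨v, hl, hm⟩
    exact hl.append hm

theorem tgt_eq_src_bar (e : E) : Γ.tgt e = Γ.src (Γ.bar e) := rfl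

theorem bar_injective : Function.Injective Γ.bar := fun e f h => by
  rw [← Γ.bar_bar e, h, Γ.bar_bar]

theorem IsTaut.of_append_cons_append {a m b : List E} {e f : E}
    (h : Γ.IsTaut (a ++ e :: (m ++ f :: b))) : Γ.IsTaut m := by
  have h1 := (List.isChain_append.1 h).2.1
  exact (List.isChain_append.1 (List.isChain_cons.1 h1).2).1

/-- If every circuit in `S` runs through some edge and, later, back through it, then `S` is a
forest: the part in between is a shorter closed path without backtracking, so an innermost such
pair would be a backtracking. -/
theorem isForest_of_exists_return {S : Set E}
    (hS : ∀ (v : V) (l : List E), (∀ e ∈ l, e ∈ S) → Γ.IsPath v l v → Γ.IsTaut l → l ≠ [] →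
      ∃ (a m b : List E) (e : E), l = a ++ e :: (m ++ Γ.bar e :: b)) :
    Γ.IsForest S := by
  suffices H : ∀ (k : ℕ) (v : V) (l : List E), l.length = k → (∀ e ∈ l, e ∈ S) →
      Γ.IsPath v l v → Γ.IsTaut l → l = [] from fun v l => H _ v l rfl
  intro k
  induction k using Nat.strong_induction_on with
  | _ k ih =>
  intro v l hk hlS hl ht
  by_contra hne
  obtain ⟨a, m, b, e, rfl⟩ := hS v l hlS hl ht hne
  obtain ⟨u, -, hu⟩ := isPath_append.1 hl
  obtain ⟨w, hm, hw⟩ := isPath_append.1 hu.2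
  obtain rfl : Γ.tgt e = w := hw.1
  obtain rfl : m = [] := by
    refine ih m.length ?_ _ m rfl (fun f hf => hlS f ?_) hm ht.of_append_cons_append
    · simp at hk
      omega
    · simp [hf]
  have h1 := (List.isChain_append.1 ht).2.1
  exact (List.isChain_cons.1 h1).1 (Γ.bar e) (by simp) rfl

variable (Γ) in
/-- A 1-cochain with values in `M`: a function on oriented edges which changes sign when the
orientation is reversed. -/
def IsCochain {M : Type*} [AddCommGroup M] (c : E → M) : Prop :=
  ∀ e, c (Γ.bar e) = -c e

section Cochain

variable {M : Type*} [AddCommGroup M] {c : E → M}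

theorem IsCochain.sum_revPath (hc : Γ.IsCochain c) (l : List E) :
    ((Γ.revPath l).map c).sum = -(l.map c).sum := by
  induction l with
  | nil => simp [revPath]
  | cons e l ih => simp [revPath_cons, ih, hc e, add_comm]

/-- The homomorphism `π₁(Γ, *) → M` given by summing a cochain along closed paths. -/
def IsCochain.toHom (hc : Γ.IsCochain c) : Γ.Pi1 →* Multiplicative M where
  toFun := Quot.lift (fun p => Multiplicative.ofAdd (p.1.map c).sum) (by
    rintro p q ⟨l, m, e, h, h'⟩
    simp [h, h', hc e])
  map_one' := rfl
  map_mul' := by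
    rintro ⟨a⟩ ⟨b⟩
    change Multiplicative.ofAdd ((a.1 ++ b.1).map c).sum = _
    rw [List.map_append, List.sum_append, ofAdd_add]

/-- The class in `π₁(Γ, *)` of a closed edge path at the basepoint. -/
def loopClass (l : List E) (h : Γ.IsPath Γ.base l Γ.base) : Γ.Pi1 := Pi1.mk ⟨l, h⟩

theorem IsCochain.toHom_loopClass (hc : Γ.IsCochain c) {l : List E}
    (h : Γ.IsPath Γ.base l Γ.base) :
    hc.toHom (loopClass l h) = Multiplicative.ofAdd (l.map c).sum := rfl

theorem loopClass_mul {l m : List E} (hl : Γ.IsPath Γ.base l Γ.base)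
    (hm : Γ.IsPath Γ.base m Γ.base) :
    loopClass l hl * loopClass m hm = loopClass (l ++ m) (hl.append hm) := rfl

theorem loopClass_inv {l : List E} (hl : Γ.IsPath Γ.base l Γ.base) :
    (loopClass l hl)⁻¹ = loopClass (Γ.revPath l) hl.rev := rfl

theorem revPath_revPath (l : List E) : Γ.revPath (Γ.revPath l) = l := by
  simp [revPath, Function.comp_def, Γ.bar_bar]

theorem loopClass_cancel {u v : V} {x t y : List E} (hx : Γ.IsPath Γ.base x u)
    (ht : Γ.IsPath v t u) (hy : Γ.IsPath u y Γ.base) :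
    loopClass (x ++ (Γ.revPath t ++ (t ++ y))) (hx.append (ht.rev.append (ht.append hy))) =
      loopClass (x ++ y) (hx.append hy) := by
  induction t generalizing v with
  | nil => rfl
  | cons e t ih =>
    rw [← ih ht.2]
    refine Quot.sound ⟨x ++ Γ.revPath t, t ++ y, Γ.bar e, ?_, ?_⟩
    · simp [revPath_cons, Γ.bar_bar]
    · simp

/-- Every homomorphism from `π₁(Γ, *)` to `M` is given by a cochain: join all vertices to the
basepoint by fixed paths, and evaluate the homomorphism on the loops through single edges. -/
theorem exists_isCochain_toHom_eq (hΓ : Γ.Connected) (χ : Γ.Pi1 →* Multiplicative M) :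
    ∃ (c : E → M) (hc : Γ.IsCochain c), hc.toHom = χ := by
  choose p hp using hΓ
  have hloop (e : E) : Γ.IsPath Γ.base (p (Γ.src e) ++ e :: Γ.revPath (p (Γ.tgt e))) Γ.base :=
    (hp _).append ⟨rfl, (hp _).rev⟩
  let c : E → M := fun e => (χ (loopClass _ (hloop e))).toAdd
  have hc : Γ.IsCochain c := by
    intro e
    change (χ _).toAdd = -(χ _).toAdd
    rw [← toAdd_inv, ← map_inv, loopClass_inv]
    congr 3
    simp only [revPath_append, revPath_cons, revPath_revPath, tgt_bar]
    simp [tgt]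
  -- A path `l` from `u` to `v` is completed to a loop by the chosen paths to `u` and `v`.
  have key (u v : V) (l : List E) (hl : Γ.IsPath u l v) :
      χ (loopClass (p u ++ (l ++ Γ.revPath (p v))) ((hp u).append (hl.append (hp v).rev))) =
        Multiplicative.ofAdd (l.map c).sum := by
    induction l generalizing u with
    | nil =>
      obtain rfl : u = v := hl
      have h := loopClass_cancel (Γ := Γ) (x := []) (y := []) rfl (hp u).rev rfl
      simp only [revPath_revPath, List.append_nil, List.nil_append] at h
      simp only [List.nil_append, h]
      exact map_one χ
    | cons e l ih =>
      obtain ⟨rfl, hl'⟩ := hl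
      have h := loopClass_cancel (Γ := Γ) (x := p (Γ.src e) ++ [e]) ((hp _).append ⟨rfl, rfl⟩)
        (hp (Γ.tgt e)) (hl'.append (hp v).rev)
      simp only [List.append_assoc, List.singleton_append] at h
      rw [List.map_cons, List.sum_cons, ofAdd_add, ← ih _ hl']
      change _ = χ (loopClass _ (hloop e)) * _
      rw [← map_mul, loopClass_mul]
      simp only [List.append_assoc, List.cons_append]
      rw [h]
  refine ⟨c, hc, ?_⟩
  ext ⟨q⟩
  change Multiplicative.ofAdd (q.1.map c).sum = χ (loopClass q.1 q.2)
  rw [← key _ _ q.1 q.2]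
  change χ (loopClass _ (hp Γ.base) * (loopClass q.1 q.2 * (loopClass _ (hp Γ.base))⁻¹)) = _
  simp

end Cochain

/-! ### Distance from the basepoint -/

variable (Γ) in
/-- The distance of a vertex from the basepoint. -/
noncomputable def depth (v : V) : ℕ := sInf {k | ∃ l, Γ.IsPath Γ.base l v ∧ l.length = k}

theorem depth_le_length {l : List E} {v : V} (h : Γ.IsPath Γ.base l v) :
    Γ.depth v ≤ l.length :=
  Nat.sInf_le ⟨l, h, rfl⟩

theorem exists_length_eq_depth (hΓ : Γ.Connected) (v : V) :
    ∃ l, Γ.IsPath Γ.base l v ∧ l.length = Γ.depth v := by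
  obtain ⟨l, hl⟩ := hΓ v
  exact Nat.sInf_mem (s := {k | ∃ l, Γ.IsPath Γ.base l v ∧ l.length = k}) ⟨_, l, hl, rfl⟩

theorem depth_le_depth_add_length (hΓ : Γ.Connected) {u v : V} {l : List E}
    (h : Γ.IsPath u l v) : Γ.depth v ≤ Γ.depth u + l.length := by
  obtain ⟨p, hp, hk⟩ := exists_length_eq_depth hΓ u
  simpa [hk] using depth_le_length (hp.append h)

/-- There is a path from the basepoint to `v` along which the distance from the basepoint
increases. -/
theorem exists_geodesic (hΓ : Γ.Connected) (v : V) :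
    ∃ l, Γ.IsPath Γ.base l v ∧
      ∀ e ∈ l, Γ.depth (Γ.src e) < Γ.depth (Γ.tgt e) ∧ Γ.depth (Γ.tgt e) ≤ Γ.depth v := by
  obtain ⟨l, hl, hk⟩ := exists_length_eq_depth hΓ v
  refine ⟨l, hl, fun e he => ?_⟩
  obtain ⟨a, b, rfl⟩ := List.append_of_mem he
  obtain ⟨u, ha, rfl, hb⟩ := isPath_append.1 hl
  have h1 := depth_le_length ha
  have h2 := depth_le_depth_add_length hΓ hb
  have h3 := depth_le_depth_add_length hΓ (l := [e]) ⟨rfl, rfl⟩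
  simp only [List.length_append, List.length_cons, List.length_nil] at hk h3
  omega

theorem tgt_ne_base {e : E} (he : Γ.depth (Γ.src e) < Γ.depth (Γ.tgt e)) :
    Γ.tgt e ≠ Γ.base := by
  intro h
  have h1 := depth_le_length (Γ := Γ) (l := []) (v := Γ.base) rfl
  rw [h] at he
  exact absurd (he.trans_le h1) (Nat.not_lt_zero _)

theorem exists_edge_above (hΓ : Γ.Connected) {v : V} (hv : v ≠ Γ.base) :
    ∃ e, Γ.tgt e = v ∧ Γ.depth (Γ.src e) < Γ.depth (Γ.tgt e) := by
  obtain ⟨l, hl, h⟩ := exists_geodesic hΓ v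
  rcases List.eq_nil_or_concat l with rfl | ⟨a, e, rfl⟩
  · exact absurd (Eq.symm hl) hv
  · rw [List.concat_eq_append] at hl h
    obtain ⟨u, -, he⟩ := isPath_append.1 hl
    exact ⟨e, he.2, (h e (by simp)).1⟩

namespace Action

variable {G : Type*} [Group G] (ρ : Γ.Action G)

theorem onE_mul_apply (g h : G) (e : E) : ρ.onE (g * h) e = ρ.onE g (ρ.onE h e) := by
  rw [map_mul, Equiv.Perm.mul_apply]

theorem onV_mul_apply (g h : G) (v : V) : ρ.onV (g * h) v = ρ.onV g (ρ.onV h v) := by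
  rw [map_mul, Equiv.Perm.mul_apply]

theorem tgt_onE (g : G) (e : E) : Γ.tgt (ρ.onE g e) = ρ.onV g (Γ.tgt e) := by
  rw [tgt, ρ.bar_onE, ρ.src_onE, tgt]

theorem depth_onV (hΓ : Γ.Connected) (g : G) (v : V) : Γ.depth (ρ.onV g v) = Γ.depth v := by
  have key (g : G) (v : V) : Γ.depth (ρ.onV g v) ≤ Γ.depth v := by
    obtain ⟨l, hl, hk⟩ := exists_length_eq_depth hΓ v
    have h := ρ.isPath_map g hl
    rw [ρ.base_onV] at h
    simpa [hk] using depth_le_length h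
  refine le_antisymm (key g v) ?_
  have h := key g⁻¹ (ρ.onV g v)
  rwa [← onV_mul_apply, inv_mul_cancel, map_one, Equiv.Perm.one_apply] at h

/-! ### Hyperelliptic involutions -/

/-- The element `s` acts as a hyperelliptic involution: it has order at most two, inverts no edge,
and acts by `-1` on homology. The last condition is expressed dually: for every cochain, the
sums over a closed path and over its image under `s` are opposite. -/
structure IsHyperelliptic (s : G) : Prop where
  mul_self : s * s = 1
  onE_ne_bar : ∀ e, ρ.onE s e ≠ Γ.bar e
  sum_onE : ∀ {M : Type} [AddCommGroup M] {c : E → M}, Γ.IsCochain c → ∀ {v : V} {l : List E},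
    Γ.IsPath v l v → ((l.map (ρ.onE s)).map c).sum = -(l.map c).sum

namespace IsHyperelliptic

variable {ρ} {s : G}

theorem onE_onE (hs : ρ.IsHyperelliptic s) (e : E) : ρ.onE s (ρ.onE s e) = e := by
  rw [← onE_mul_apply, hs.mul_self, map_one, Equiv.Perm.one_apply]

/-- The quotient by a hyperelliptic involution has no homology: invariant cochains vanish on
closed paths. -/
theorem sum_eq_zero (hs : ρ.IsHyperelliptic s) {c : E → ℤ} (hc : Γ.IsCochain c)
    (hcs : ∀ e, c (ρ.onE s e) = c e) {v : V} {l : List E} (hl : Γ.IsPath v l v) :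
    (l.map c).sum = 0 := by
  have h := hs.sum_onE hc hl
  have h1 : c ∘ ρ.onE s = c := funext hcs
  rw [List.map_map, h1] at h
  omega

variable (ρ s) in
open scoped Classical in
/-- The cochain counting, with sign, the passages through the edges `e` and `s e`. -/
noncomputable def cut (e f : E) : ℤ :=
  if f = e ∨ f = ρ.onE s e then 1
  else if f = Γ.bar e ∨ f = Γ.bar (ρ.onE s e) then -1
  else 0

theorem cut_self (e : E) : cut ρ s e e = 1 := by simp [cut]

theorem isCochain_cut (hs : ρ.IsHyperelliptic s) (e : E) : Γ.IsCochain (cut ρ s e) := by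
  intro f
  have h1 := Γ.bar_bar
  have h2 := Γ.bar_ne
  have h3 := hs.onE_ne_bar
  unfold cut
  grind

theorem cut_onE (hs : ρ.IsHyperelliptic s) (e f : E) :
    cut ρ s e (ρ.onE s f) = cut ρ s e f := by
  have h1 := hs.onE_onE
  have h2 := ρ.bar_onE s
  unfold cut
  grind

theorem exists_mem_bar (hs : ρ.IsHyperelliptic s) {v : V} {l : List E} (hl : Γ.IsPath v l v)
    {e : E} (he : e ∈ l) : Γ.bar e ∈ l ∨ Γ.bar (ρ.onE s e) ∈ l := by
  by_contra! h
  have h0 := hs.sum_eq_zero (hs.isCochain_cut e) (hs.cut_onE e) hl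
  have h1 : cut ρ s e e ≤ (l.map (cut ρ s e)).sum := by
    refine List.single_le_sum (fun x hx => ?_) _ (List.mem_map_of_mem he)
    obtain ⟨f, hf, rfl⟩ := List.mem_map.1 hx
    unfold cut
    grind
  rw [h0, cut_self] at h1
  omega

/-- The edges fixed by a hyperelliptic involution form a forest, since an invariant circuit would
be nontrivial in homology. -/
theorem isForest_fixed (hs : ρ.IsHyperelliptic s) : Γ.IsForest {e | ρ.onE s e = e} := by
  refine isForest_of_exists_return fun v l hlS hl _ hne => ?_
  obtain ⟨e, he⟩ := List.exists_mem_of_ne_nil l hne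
  have hbar : Γ.bar e ∈ l := by
    have h := hs.exists_mem_bar hl he
    rwa [hlS e he, or_self] at h
  obtain ⟨a, b, rfl⟩ := List.append_of_mem he
  simp only [List.mem_append, List.mem_cons, Γ.bar_ne, false_or] at hbar
  rcases hbar with h | h
  · obtain ⟨a', m, rfl⟩ := List.append_of_mem h
    exact ⟨a', m, b, Γ.bar e, by simp [Γ.bar_bar]⟩
  · obtain ⟨m, b', rfl⟩ := List.append_of_mem h
    exact ⟨a, m, b', e, rfl⟩

theorem cut_eq_zero {e f : E} (h : ∀ g, g = e ∨ g = ρ.onE s e → f ≠ g ∧ f ≠ Γ.bar g) :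
    cut ρ s e f = 0 := by
  have h1 := h e (Or.inl rfl)
  have h2 := h _ (Or.inr rfl)
  simp [cut, h1, h2]

theorem sum_cut_eq_zero {e : E} {l : List E}
    (h : ∀ f ∈ l, ∀ g, g = e ∨ g = ρ.onE s e → f ≠ g ∧ f ≠ Γ.bar g) :
    (l.map (cut ρ s e)).sum = 0 := by
  refine List.sum_eq_zero fun x hx => ?_
  obtain ⟨f, hf, rfl⟩ := List.mem_map.1 hx
  exact cut_eq_zero (h f hf)

/-- No edge joins two vertices at the same distance from the basepoint. -/
theorem depth_src_ne_depth_tgt (hs : ρ.IsHyperelliptic s) (hΓ : Γ.Connected) (e : E) :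
    Γ.depth (Γ.src e) ≠ Γ.depth (Γ.tgt e) := by
  intro heq
  obtain ⟨p, hp, hp'⟩ := exists_geodesic hΓ (Γ.src e)
  obtain ⟨q, hq, hq'⟩ := exists_geodesic hΓ (Γ.tgt e)
  have hl : Γ.IsPath Γ.base (p ++ e :: Γ.revPath q) Γ.base := hp.append ⟨rfl, hq.rev⟩
  have hflat (g : E) (hg : g = e ∨ g = ρ.onE s e) : Γ.depth (Γ.src g) = Γ.depth (Γ.tgt g) := by
    rcases hg with rfl | rfl
    · exact heq
    · rw [ρ.src_onE, tgt_onE, ρ.depth_onV hΓ, ρ.depth_onV hΓ, heq]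
  have hzero (f : E) (hf : Γ.depth (Γ.src f) < Γ.depth (Γ.tgt f)) (g : E)
      (hg : g = e ∨ g = ρ.onE s e) : f ≠ g ∧ f ≠ Γ.bar g := by
    have h := hflat g hg
    constructor
    · rintro rfl
      omega
    · rintro rfl
      rw [tgt_bar, ← tgt_eq_src_bar] at hf
      omega
  have h0 := hs.sum_eq_zero (hs.isCochain_cut e) (hs.cut_onE e) hl
  rw [List.map_append, List.map_cons, List.sum_append, List.sum_cons,
    (hs.isCochain_cut e).sum_revPath, sum_cut_eq_zero fun f hf => hzero f (hp' f hf).1,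
    sum_cut_eq_zero fun f hf => hzero f (hq' f hf).1, cut_self] at h0
  omega

/-- The edge through which a vertex is reached from the basepoint is unique up to the involution:
two such edges, not in one orbit, would give a circuit in the quotient. -/
theorem eq_or_eq_onE (hs : ρ.IsHyperelliptic s) (hΓ : Γ.Connected) {e f : E}
    (hef : Γ.tgt f = Γ.tgt e) (he : Γ.depth (Γ.src e) < Γ.depth (Γ.tgt e))
    (hf : Γ.depth (Γ.src f) < Γ.depth (Γ.tgt f)) : f = e ∨ f = ρ.onE s e := by
  obtain ⟨p, hp, hp'⟩ := exists_geodesic hΓ (Γ.src e)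
  obtain ⟨q, hq, hq'⟩ := exists_geodesic hΓ (Γ.src f)
  have hl : Γ.IsPath Γ.base (p ++ e :: Γ.bar f :: Γ.revPath q) Γ.base :=
    hp.append ⟨rfl, hef, by rw [tgt_bar]; exact hq.rev⟩
  have hdepth (g : E) (hg : g = e ∨ g = ρ.onE s e) : Γ.depth (Γ.tgt g) = Γ.depth (Γ.tgt e) := by
    rcases hg with rfl | rfl
    · rfl
    · rw [tgt_onE, ρ.depth_onV hΓ]
  have hzero (k : E) (hk : Γ.depth (Γ.src k) < Γ.depth (Γ.tgt k))
      (hk' : Γ.depth (Γ.tgt k) < Γ.depth (Γ.tgt e)) (g : E)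
      (hg : g = e ∨ g = ρ.onE s e) : k ≠ g ∧ k ≠ Γ.bar g := by
    have h := hdepth g hg
    constructor
    · rintro rfl
      omega
    · rintro rfl
      rw [← tgt_eq_src_bar] at hk
      omega
  have h0 := hs.sum_eq_zero (hs.isCochain_cut e) (hs.cut_onE e) hl
  rw [List.map_append, List.map_cons, List.map_cons, List.sum_append, List.sum_cons, List.sum_cons,
    (hs.isCochain_cut e).sum_revPath, (hs.isCochain_cut e) f,
    sum_cut_eq_zero fun k hk => hzero k (hp' k hk).1 ((hp' k hk).2.trans_lt he),
    sum_cut_eq_zero fun k hk => hzero k (hq' k hk).1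
      ((hq' k hk).2.trans_lt (hf.trans_eq (by rw [hef]))), cut_self] at h0
  by_contra! h
  have h1 : cut ρ s e f ≤ 0 := by
    unfold cut
    grind
  omega

variable (ρ s) in
/-- The edges whose endpoint farther from the basepoint is moved by `s`. -/
def movedEdges : Set E :=
  {e | (Γ.depth (Γ.src e) < Γ.depth (Γ.tgt e) ∧ ρ.onV s (Γ.tgt e) ≠ Γ.tgt e) ∨
    (Γ.depth (Γ.tgt e) < Γ.depth (Γ.src e) ∧ ρ.onV s (Γ.src e) ≠ Γ.src e)}

theorem bar_mem_movedEdges {e : E} (he : e ∈ movedEdges ρ s) : Γ.bar e ∈ movedEdges ρ s := by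
  simp only [movedEdges, Set.mem_ofPred_eq, tgt_bar, ← tgt_eq_src_bar] at he ⊢
  exact he.symm

theorem onE_mem_movedEdges (hΓ : Γ.Connected) {g : G} (hg : s * g = g * s) {e : E}
    (he : e ∈ movedEdges ρ s) : ρ.onE g e ∈ movedEdges ρ s := by
  have h (v : V) : ρ.onV s (ρ.onV g v) = ρ.onV g (ρ.onV s v) := by
    rw [← onV_mul_apply, hg, onV_mul_apply]
  simpa only [movedEdges, Set.mem_ofPred_eq, tgt_onE, ρ.src_onE, ρ.depth_onV hΓ, h, ne_eq,
    EmbeddingLike.apply_eq_iff_eq] using he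

/-- Two of the moved edges leading away from the basepoint to the same vertex are equal, as the
involution carries the one to an edge ending elsewhere. -/
theorem eq_of_mem_movedEdges (hs : ρ.IsHyperelliptic s) (hΓ : Γ.Connected) {e f : E}
    (heS : e ∈ movedEdges ρ s) (hef : Γ.tgt f = Γ.tgt e)
    (he : Γ.depth (Γ.src e) < Γ.depth (Γ.tgt e)) (hf : Γ.depth (Γ.src f) < Γ.depth (Γ.tgt f)) :
    f = e := by
  rcases hs.eq_or_eq_onE hΓ hef he hf with h | rfl
  · exact h
  · rw [tgt_onE] at hef
    rcases heS with h | h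
    · exact absurd hef h.2
    · omega

/-- A path without backtracking in the moved edges which starts away from the basepoint continues
so. -/
theorem depth_lt_of_isTaut (hs : ρ.IsHyperelliptic s) (hΓ : Γ.Connected) {e : E} {l : List E}
    {v : V} (hS : ∀ f ∈ e :: l, f ∈ movedEdges ρ s) (hl : Γ.IsPath (Γ.tgt e) l v)
    (ht : Γ.IsTaut (e :: l)) (he : Γ.depth (Γ.src e) < Γ.depth (Γ.tgt e)) :
    Γ.depth (Γ.src e) < Γ.depth v := by
  induction l generalizing e with
  | nil =>
    obtain rfl : Γ.tgt e = v := hl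
    exact he
  | cons f l ih =>
    have hfe := (List.isChain_cons.1 ht).1 f (by simp)
    have hf : Γ.depth (Γ.src f) < Γ.depth (Γ.tgt f) := by
      by_contra hf
      have hf' := lt_of_le_of_ne (not_lt.1 hf) (hs.depth_src_ne_depth_tgt hΓ f).symm
      refine hfe ?_
      rw [← hs.eq_of_mem_movedEdges hΓ (hS e (by simp)) (f := Γ.bar f)
        ((tgt_bar f).trans hl.1) he (by rwa [tgt_bar]), Γ.bar_bar]
    have h := ih (fun g hg => hS g (List.mem_cons_of_mem _ hg)) hl.2 (List.isChain_cons.1 ht).2 hf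
    rw [hl.1] at h
    omega

theorem isTaut_revPath {l : List E} (h : Γ.IsTaut l) : Γ.IsTaut (Γ.revPath l) := by
  rw [IsTaut, revPath, List.isChain_reverse, List.isChain_map]
  refine h.imp fun e f hef hb => hef ?_
  rw [Γ.bar_bar] at hb
  exact hb.symm

/-- The moved edges form a forest, because each vertex is the farther end of at most one of
them: a circuit would leave and return to its first vertex through the same edge. -/
theorem isForest_movedEdges (hs : ρ.IsHyperelliptic s) (hΓ : Γ.Connected) :
    Γ.IsForest (movedEdges ρ s) := by
  refine isForest_of_exists_return fun v l hlS hl ht hne => ?_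
  -- A circuit starts towards the basepoint, and so does its reverse.
  have hfirst (e : E) (l : List E) (hS : ∀ f ∈ e :: l, f ∈ movedEdges ρ s)
      (hl : Γ.IsPath v (e :: l) v) (ht : Γ.IsTaut (e :: l)) :
      Γ.depth (Γ.tgt e) < Γ.depth (Γ.src e) := by
    by_contra h
    have h' := lt_of_le_of_ne (not_lt.1 h) (hs.depth_src_ne_depth_tgt hΓ e)
    have h1 := hs.depth_lt_of_isTaut hΓ hS hl.2 ht h'
    rw [hl.1] at h1
    omega
  obtain ⟨e, l, rfl⟩ := List.exists_cons_of_ne_nil hne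
  have he := hfirst e l hlS hl ht
  rcases List.eq_nil_or_concat l with rfl | ⟨m, f, rfl⟩
  · have h1 : Γ.tgt e = v := hl.2
    rw [h1, hl.1] at he
    omega
  · rw [List.concat_eq_append] at *
    have hrev : Γ.revPath (e :: (m ++ [f])) = Γ.bar f :: Γ.revPath (e :: m) := by
      rw [← List.cons_append, revPath_append]
      rfl
    have hf : Γ.depth (Γ.tgt (Γ.bar f)) < Γ.depth (Γ.src (Γ.bar f)) := by
      refine hfirst _ (Γ.revPath (e :: m)) (fun g hg => ?_) (hrev ▸ hl.rev)
        (hrev ▸ isTaut_revPath ht)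
      rw [← hrev, revPath, List.mem_reverse, List.mem_map] at hg
      obtain ⟨k, hk, rfl⟩ := hg
      exact bar_mem_movedEdges (hlS k hk)
    rw [tgt_bar, ← tgt_eq_src_bar] at hf
    obtain ⟨u, -, hu⟩ := isPath_append.1 hl.2
    have hfv : Γ.tgt f = v := hu.2
    refine ⟨[], m, [], e, ?_⟩
    rw [hs.eq_of_mem_movedEdges hΓ (e := Γ.bar e) (f := f) (bar_mem_movedEdges (hlS e (by simp)))
      (by rw [tgt_bar, hl.1, hfv]) (by rwa [tgt_bar]) hf]
    rfl

end IsHyperelliptic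

end Action

/-! ### The tree of a hyperelliptic involution fixing the vertices -/

variable (Γ) in
/-- The simple graph on the vertices of `Γ` in which two distinct vertices are adjacent if they are
joined by an edge of `Γ`. -/
def simple : SimpleGraph V where
  Adj u v := u ≠ v ∧ ∃ e, Γ.src e = u ∧ Γ.tgt e = v
  symm := ⟨by
    rintro u v ⟨h, e, rfl, rfl⟩
    exact ⟨h.symm, Γ.bar e, rfl, tgt_bar e⟩⟩
  loopless := ⟨fun v h => h.1 rfl⟩

theorem reachable_of_isPath {u v : V} {l : List E} (h : Γ.IsPath u l v) :
    Γ.simple.Reachable u v := by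
  induction l generalizing u with
  | nil =>
    obtain rfl : u = v := h
    rfl
  | cons e l ih =>
    refine SimpleGraph.Reachable.trans ?_ (ih h.2)
    by_cases hu : u = Γ.tgt e
    · rw [← hu]
    · exact SimpleGraph.Adj.reachable ⟨hu, e, h.1, rfl⟩

theorem connected_simple (hΓ : Γ.Connected) : Γ.simple.Connected := by
  have h (v : V) : Γ.simple.Reachable Γ.base v := reachable_of_isPath (hΓ v).choose_spec
  exact { preconnected := fun u v => (h u).symm.trans (h v), nonempty := ⟨Γ.base⟩ }

namespace Action

variable {G : Type*} [Group G] {ρ : Γ.Action G} {s : G}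

namespace IsHyperelliptic

theorem simple_adj (hs : ρ.IsHyperelliptic s) (hΓ : Γ.Connected) (e : E) :
    Γ.simple.Adj (Γ.src e) (Γ.tgt e) := by
  refine ⟨fun h => hs.depth_src_ne_depth_tgt hΓ e ?_, e, rfl, rfl⟩
  rw [← h]

/-- Away from the basepoint, vertices correspond to edges of the tree: each to the edge through
which it is reached. -/
theorem card_edgeSet_simple (hs : ρ.IsHyperelliptic s) (hΓ : Γ.Connected)
    (hV : ∀ v, ρ.onV s v = v) :
    Nat.card Γ.simple.edgeSet = Nat.card {v // v ≠ Γ.base} := by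
  choose r hr hr' using fun v : {v // v ≠ Γ.base} => exists_edge_above hΓ v.2
  refine (Nat.card_congr (Equiv.ofBijective
    (fun v => (⟨s(Γ.src (r v), Γ.tgt (r v)), hs.simple_adj hΓ (r v)⟩ : Γ.simple.edgeSet))
    ⟨fun v w h => ?_, ?_⟩)).symm
  · have h1 := hr' v
    have h2 := hr' w
    rcases Sym2.eq_iff.1 (congrArg Subtype.val h) with ⟨-, h3⟩ | ⟨h3, h4⟩
    · rw [hr, hr] at h3
      exact Subtype.ext h3
    · rw [h3, h4] at h1
      omega
  · rintro ⟨z, hz⟩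
    induction z with | _ u v =>
    obtain ⟨huv, e, rfl, rfl⟩ : Γ.simple.Adj u v := hz
    have key (e : E) (he : Γ.depth (Γ.src e) < Γ.depth (Γ.tgt e)) :
        ∃ w, s(Γ.src (r w), Γ.tgt (r w)) = s(Γ.src e, Γ.tgt e) := by
      have hne : Γ.tgt e ≠ Γ.base := tgt_ne_base he
      refine ⟨⟨_, hne⟩, ?_⟩
      rcases hs.eq_or_eq_onE hΓ (hr ⟨_, hne⟩) he (hr' _) with h | h
      · rw [h]
      · rw [h, ρ.src_onE, tgt_onE, hV, hV]
    rcases lt_or_gt_of_ne (hs.depth_src_ne_depth_tgt hΓ e) with he | he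
    · obtain ⟨w, hw⟩ := key e he
      exact ⟨w, Subtype.ext hw⟩
    · obtain ⟨w, hw⟩ := key (Γ.bar e) (by rwa [tgt_bar])
      rw [tgt_bar, ← tgt_eq_src_bar, Sym2.eq_swap (a := Γ.tgt e)] at hw
      exact ⟨w, Subtype.ext hw⟩

theorem card_vertices [Finite V] : Nat.card {v // v ≠ Γ.base} + 1 = Nat.card V := by
  classical
  have := Fintype.ofFinite V
  have : 0 < Fintype.card V := Fintype.card_pos_iff.2 ⟨Γ.base⟩
  rw [Nat.card_eq_fintype_card, Nat.card_eq_fintype_card, Fintype.card_subtype_compl,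
    Fintype.card_subtype_eq]
  omega

theorem isTree_simple [Finite V] (hs : ρ.IsHyperelliptic s) (hΓ : Γ.Connected)
    (hV : ∀ v, ρ.onV s v = v) : Γ.simple.IsTree := by
  rw [SimpleGraph.isTree_iff_connected_and_card]
  exact ⟨connected_simple hΓ, by rw [hs.card_edgeSet_simple hΓ hV, card_vertices]⟩

theorem eq_or_eq_onE_of_src_eq_of_tgt_eq (hs : ρ.IsHyperelliptic s) (hΓ : Γ.Connected) {e f : E}
    (h1 : Γ.src f = Γ.src e) (h2 : Γ.tgt f = Γ.tgt e) : f = e ∨ f = ρ.onE s e := by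
  rcases lt_or_gt_of_ne (hs.depth_src_ne_depth_tgt hΓ e) with he | he
  · exact hs.eq_or_eq_onE hΓ h2 he (by rwa [h1, h2])
  · have h := hs.eq_or_eq_onE hΓ (e := Γ.bar e) (f := Γ.bar f) (by rw [tgt_bar, tgt_bar, h1])
      (by rwa [tgt_bar]) (by rw [tgt_bar, ← tgt_eq_src_bar, h1, h2]; exact he)
    rw [← ρ.bar_onE] at h
    exact h.imp (fun h => bar_injective h) (fun h => bar_injective h)

/-- A labelling of the edges which distinguishes each edge from its image under the involution,
but not from its inverse. It compares the two pairs `{e, bar e}` and `{s e, bar (s e)}` by their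
least elements for an enumeration of the edges. -/
theorem exists_label [Finite E] (hs : ρ.IsHyperelliptic s) (hE : ∀ e, ρ.onE s e ≠ e) :
    ∃ b : E → Bool, (∀ e, b (Γ.bar e) = b e) ∧ ∀ e, b (ρ.onE s e) = !b e := by
  obtain ⟨k, ⟨i⟩⟩ := Finite.exists_equiv_fin E
  let m : E → Fin k := fun e => min (i e) (i (Γ.bar e))
  have hm (e : E) : m (Γ.bar e) = m e := by
    simp only [m, Γ.bar_bar, min_comm]
  have hne (e : E) : m (ρ.onE s e) ≠ m e := by
    have h1 := hE e
    have h2 := hs.onE_ne_bar e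
    have h3 : Γ.bar (ρ.onE s e) ≠ e := fun h => h2 (by rw [← h, Γ.bar_bar, h])
    have h4 : Γ.bar (ρ.onE s e) ≠ Γ.bar e := fun h => h1 (bar_injective h)
    rw [← i.injective.ne_iff] at h1 h2 h3 h4
    simp only [m]
    grind
  refine ⟨fun e => decide (m e < m (ρ.onE s e)), fun e => ?_, fun e => ?_⟩
  · simp only [← ρ.bar_onE, hm]
  · simp only [hs.onE_onE, ← decide_not, not_lt]
    exact decide_eq_decide.2 (le_iff_lt_or_eq.trans (or_iff_left (hne e))).symm

/-- The `θ₁`-tree structure given by a hyperelliptic involution which fixes all vertices and no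
edge. -/
theorem exists_thetaOneTree [Finite V] [Finite E] {n : ℕ} (hs : ρ.IsHyperelliptic s)
    (hΓ : Γ.Connected) (hV : ∀ v, ρ.onV s v = v) (hE : ∀ e, ρ.onE s e ≠ e)
    (hn : Nat.card {v // v ≠ Γ.base} = n) :
    ∃ D : Γ.ThetaOneTree n, ∀ e, ρ.onE s e = D.switch e := by
  obtain ⟨b, hbar, hb⟩ := hs.exists_label hE
  let double : E → Γ.simple.Dart × Bool := fun e => (⟨(Γ.src e, Γ.tgt e), hs.simple_adj hΓ e⟩, b e)
  have hdouble : Function.Bijective double := by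
    refine ⟨fun e f h => ?_, ?_⟩
    · have h1 := congrArg (fun x => x.1.fst) h
      have h2 := congrArg (fun x => x.1.snd) h
      have h3 : b e = b f := congrArg Prod.snd h
      rcases hs.eq_or_eq_onE_of_src_eq_of_tgt_eq hΓ h1 h2 with h | rfl
      · exact h
      · rw [hb] at h3
        simp at h3
    · rintro ⟨⟨⟨u, v⟩, hadj⟩, c⟩
      obtain ⟨hne, e, rfl, rfl⟩ : Γ.simple.Adj u v := hadj
      by_cases hc : b e = c
      · exact ⟨e, by subst hc; rfl⟩
      · refine ⟨ρ.onE s e, Prod.ext (SimpleGraph.Dart.toProd_injective (Prod.ext ?_ ?_)) ?_⟩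
        · exact (ρ.src_onE s e).trans (hV _)
        · exact (ρ.tgt_onE s e).trans (hV _)
        · change b (ρ.onE s e) = c
          rw [hb]
          cases c <;> simpa using hc
  refine ⟨{ T := Γ.simple
            isTree := hs.isTree_simple hΓ hV
            card_edges := by
              rw [← Nat.card_coe_set_eq, hs.card_edgeSet_simple hΓ hV, hn]
            double := Equiv.ofBijective double hdouble
            src_double := fun e => rfl
            bar_double := fun e => ?_ }, fun e => ?_⟩
  · exact Prod.ext (SimpleGraph.Dart.toProd_injective (Prod.ext rfl (tgt_bar e))) (hbar e)
  · refine ((Equiv.symm_apply_eq (Equiv.ofBijective double hdouble)).2 ?_).symm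
    refine Prod.ext (SimpleGraph.Dart.toProd_injective (Prod.ext ?_ ?_)) (hb e).symm
    · exact ((ρ.src_onE s e).trans (hV _)).symm
    · exact ((ρ.tgt_onE s e).trans (hV _)).symm

/-! ### The rank -/

/-- The cochain with values `± t v` on the pair of edges through which `v` is reached from the
basepoint, the sign being given by a labelling `b` of the edges. -/
noncomputable def pairCochain (b : E → Bool) (t : V → ZMod 3) (e : E) : ZMod 3 :=
  (if b e then 1 else -1) *
    if Γ.depth (Γ.src e) < Γ.depth (Γ.tgt e) then t (Γ.tgt e) else -t (Γ.src e)

theorem isCochain_pairCochain (hs : ρ.IsHyperelliptic s) (hΓ : Γ.Connected) {b : E → Bool}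
    (hbar : ∀ e, b (Γ.bar e) = b e) (t : V → ZMod 3) :
    Γ.IsCochain (pairCochain (Γ := Γ) b t) := by
  intro e
  unfold pairCochain
  rw [hbar, tgt_bar, ← tgt_eq_src_bar]
  rcases lt_or_gt_of_ne (hs.depth_src_ne_depth_tgt hΓ e) with he | he
  · rw [if_neg he.not_gt, if_pos he, mul_neg]
  · rw [if_neg he.not_gt, if_pos he, mul_neg, neg_neg]

theorem pairCochain_onE (hV : ∀ v, ρ.onV s v = v) {b : E → Bool}
    (hb : ∀ e, b (ρ.onE s e) = !b e) (t : V → ZMod 3) (e : E) :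
    pairCochain (Γ := Γ) b t (ρ.onE s e) = -pairCochain (Γ := Γ) b t e := by
  unfold pairCochain
  rw [hb, tgt_onE, ρ.src_onE, hV, hV]
  split_ifs <;> simp_all

/-- Every class in `H¹(Γ; 𝔽₃)` has exactly one representative which the involution negates: as `2`
is invertible, a cochain can be averaged. Such cochains are given by one value for each vertex
other than the basepoint. -/
theorem card_hom_pi1 [Finite E] (hs : ρ.IsHyperelliptic s)
    (hΓ : Γ.Connected) (hV : ∀ v, ρ.onV s v = v) (hE : ∀ e, ρ.onE s e ≠ e) :
    Nat.card (Γ.Pi1 →* Multiplicative (ZMod 3)) = Nat.card ({v // v ≠ Γ.base} → ZMod 3) := by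
  classical
  obtain ⟨b, hbar, hb⟩ := hs.exists_label hE
  let ext : ({v // v ≠ Γ.base} → ZMod 3) → V → ZMod 3 :=
    fun t v => if h : v ≠ Γ.base then t ⟨v, h⟩ else 0
  have hc (t : V → ZMod 3) := hs.isCochain_pairCochain hΓ hbar t
  refine (Nat.card_congr (Equiv.ofBijective (fun t => (hc (ext t)).toHom) ⟨?_, ?_⟩)).symm
  · intro t t' h
    funext v
    obtain ⟨e, hev, he⟩ := exists_edge_above hΓ v.2
    obtain ⟨p, hp⟩ := hΓ (Γ.src e)
    -- The loop through `e` and back through its image.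
    have hl : Γ.IsPath Γ.base (p ++ e :: Γ.bar (ρ.onE s e) :: Γ.revPath p) Γ.base := by
      refine hp.append ⟨rfl, ?_, ?_⟩
      · rw [← tgt_eq_src_bar, tgt_onE, hV]
      · rw [tgt_bar, ρ.src_onE, hV]
        exact hp.rev
    have hval (t : V → ZMod 3) :
        ((hc t).toHom (loopClass _ hl)).toAdd = 2 * pairCochain (Γ := Γ) b t e := by
      rw [(hc t).toHom_loopClass, toAdd_ofAdd, List.map_append, List.map_cons, List.map_cons,
        List.sum_append, List.sum_cons, List.sum_cons, (hc t).sum_revPath, hc t,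
        pairCochain_onE hV hb]
      ring
    have h1 := hval (ext t)
    rw [show (hc (ext t)).toHom = (hc (ext t')).toHom from h, hval] at h1
    have hext (t : {v // v ≠ Γ.base} → ZMod 3) : ext t v = t v := by simp [ext, v.2]
    simp only [pairCochain, if_pos he] at h1
    rw [hev, hext, hext] at h1
    have h2 : ∀ x y : ZMod 3, 2 * x = 2 * y → x = y := by decide
    have h3 := h2 _ _ h1
    cases hbe : b e <;> simpa [hbe] using h3.symm
  · intro χ
    obtain ⟨c, hcc, rfl⟩ := exists_isCochain_toHom_eq hΓ χ
    -- The average `(c - c ∘ s) / 2`, where `1 / 2 = -1`.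
    let d : E → ZMod 3 := fun e => c (ρ.onE s e) - c e
    have hd : Γ.IsCochain d := by
      intro e
      simp only [d]
      rw [← ρ.bar_onE, hcc, hcc]
      ring
    have hds (e : E) : d (ρ.onE s e) = -d e := by
      simp only [d, hs.onE_onE, neg_sub]
    let r : V → ZMod 3 := fun v =>
      if h : v ≠ Γ.base then
        (if b (exists_edge_above hΓ h).choose then 1 else -1) * d (exists_edge_above hΓ h).choose
      else 0
    have hsign (x : Bool) (y : ZMod 3) :
        (if x then 1 else -1) * ((if x then 1 else -1) * y) = y := by
      cases x <;> simp
    have hdown (e : E) (he : Γ.depth (Γ.src e) < Γ.depth (Γ.tgt e)) :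
        pairCochain (Γ := Γ) b r e = d e := by
      have hne : Γ.tgt e ≠ Γ.base := tgt_ne_base he
      obtain ⟨h1, h2⟩ := (exists_edge_above hΓ hne).choose_spec
      simp only [pairCochain, if_pos he, r, dif_pos hne]
      rcases hs.eq_or_eq_onE hΓ h1 he h2 with h | h
      · rw [h, hsign]
      · rw [h, hb, hds]
        cases b e <;> simp
    have hrd : pairCochain (Γ := Γ) b r = d := by
      funext e
      rcases lt_or_gt_of_ne (hs.depth_src_ne_depth_tgt hΓ e) with he | he
      · exact hdown e he
      · have h := hdown (Γ.bar e) (by rwa [tgt_bar])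
        rwa [hc, hd, neg_inj] at h
    refine ⟨fun v => r v, ?_⟩
    have hext : ext (fun v => r v) = r := by
      funext v
      by_cases h : v = Γ.base <;> simp [ext, r, h]
    ext ⟨q⟩
    change Multiplicative.ofAdd (q.1.map (pairCochain (Γ := Γ) b _)).sum =
      Multiplicative.ofAdd (q.1.map c).sum
    rw [hext, hrd]
    have h1 : (q.1.map d).sum = ((q.1.map (ρ.onE s)).map c).sum - (q.1.map c).sum := by
      rw [List.map_map]
      exact Multiset.sum_map_sub (m := (q.1 : Multiset E))
    have h2 : ∀ x : ZMod 3, -x - x = x := by decide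
    rw [h1, hs.sum_onE hcc q.2, h2]

/-- The rank of the fundamental group is read off from the number of homomorphisms to `ℤ/3`. -/
theorem card_eq_rank [Finite V] [Finite E] {n : ℕ} (hs : ρ.IsHyperelliptic s)
    (hΓ : Γ.Connected) (hV : ∀ v, ρ.onV s v = v) (hE : ∀ e, ρ.onE s e ≠ e)
    (φ : FreeGroup (Fin n) ≃* Γ.Pi1) : Nat.card {v // v ≠ Γ.base} = n := by
  have h := hs.card_hom_pi1 hΓ hV hE
  rw [← Nat.card_congr (FreeGroup.lift.trans
    (φ.monoidHomCongrLeftEquiv (N := Multiplicative (ZMod 3))))] at h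
  simp only [Nat.card_fun, Nat.card_eq_fintype_card (α := Fin n), Fintype.card_fin] at h
  have h3 : Nat.card (Multiplicative (ZMod 3)) = 3 := by
    rw [Nat.card_congr Multiplicative.toAdd, Nat.card_zmod]
  rw [h3, Nat.card_zmod] at h
  exact (Nat.pow_right_injective (a := 3) (by norm_num) h).symm

/-! ### Reducedness -/

/-- The forest of edges fixed by a central element is invariant under the whole group. -/
theorem onE_ne (hs : ρ.IsHyperelliptic s) (hred : ρ.IsReduced) (hcomm : ∀ g, s * g = g * s)
    (e : E) : ρ.onE s e ≠ e := by
  intro he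
  refine hred {e | ρ.onE s e = e} ⟨e, he⟩ (fun f hf => ?_) (fun g f hf => ?_) hs.isForest_fixed
  · change ρ.onE s (Γ.bar f) = Γ.bar f
    rw [← ρ.bar_onE, show ρ.onE s f = f from hf]
  · change ρ.onE s (ρ.onE g f) = ρ.onE g f
    rw [← onE_mul_apply, hcomm, onE_mul_apply, show ρ.onE s f = f from hf]

/-- The forest of moved edges is invariant under the whole group, as distances are preserved and
`s` is central. If `s` moves a vertex, the last edge of a shortest path to it lies in this forest. -/
theorem onV_eq (hs : ρ.IsHyperelliptic s) (hΓ : Γ.Connected) (hred : ρ.IsReduced)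
    (hcomm : ∀ g, s * g = g * s) (v : V) : ρ.onV s v = v := by
  by_contra hv
  obtain ⟨e, rfl, he⟩ := exists_edge_above hΓ (v := v) (by
    rintro rfl
    exact hv (ρ.base_onV s))
  exact hred _ ⟨e, Or.inl ⟨he, hv⟩⟩ (fun f hf => bar_mem_movedEdges hf)
    (fun g f hf => onE_mem_movedEdges hΓ (hcomm g) hf) (hs.isForest_movedEdges hΓ)

end IsHyperelliptic

/-- If `s` fixes all vertices, then each edge forms a circuit with its image, so that `⟨s⟩` has no
invariant forest. -/
theorem isReduced_restrict_zpowers (hV : ∀ v, ρ.onV s v = v)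
    (hE : ∀ e, ρ.onE s e ≠ e) : (ρ.restrict (Subgroup.zpowers s)).IsReduced := by
  rintro S ⟨e, he⟩ hbar hinv hS
  have hse : ρ.onE s e ∈ S := hinv ⟨s, Subgroup.mem_zpowers s⟩ e he
  have h := hS (Γ.src e) [e, Γ.bar (ρ.onE s e)] ?_ ⟨rfl, ?_, ?_⟩ ?_
  · simp at h
  · simp only [List.mem_cons, List.not_mem_nil, or_false]
    rintro f (rfl | rfl)
    exacts [he, hbar _ hse]
  · rw [← tgt_eq_src_bar, tgt_onE, hV]
  · change Γ.tgt (Γ.bar (ρ.onE s e)) = Γ.src e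
    rw [tgt_bar, ρ.src_onE, hV]
  · simp only [IsTaut, List.isChain_cons_cons, List.isChain_singleton, and_true]
    exact fun h => hE e (bar_injective h)

end Action

/-! ### The involution `σ_n` -/

theorem hom_sigma {n : ℕ} {M : Type*} [CommGroup M] (χ : FreeGroup (Fin n) →* M)
    (w : FreeGroup (Fin n)) : χ (sigma n w) = (χ w)⁻¹ := by
  have h : χ.comp (sigma n).toMonoidHom = χ⁻¹ := by
    ext i
    simp [sigma_of]
  exact DFunLike.congr_fun h w

theorem sigma_mul_sigma (n : ℕ) : sigma n * sigma n = 1 := by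
  have h : (sigma n * sigma n).toMonoidHom = MonoidHom.id _ := by
    ext i
    simp [sigma_of]
  ext w
  exact DFunLike.congr_fun h w

/-- If an action without inversions realizes `σ_n`, then `σ_n` acts as a hyperelliptic involution:
`σ_n` inverts the generators, hence composes to the inverse with any homomorphism to an abelian
group. -/
theorem isHyperelliptic_sigma {n : ℕ} {A : Subgroup (MulAut (FreeGroup (Fin n)))}
    (hσ : sigma n ∈ A) (hΓ : Γ.Connected) {φ : FreeGroup (Fin n) ≃* Γ.Pi1} {ρ : Γ.Action A}
    (hρ : Γ.Realizes A φ ρ) (hinv : ρ.WithoutInversions) :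
    ρ.IsHyperelliptic ⟨sigma n, hσ⟩ where
  mul_self := Subtype.ext (sigma_mul_sigma n)
  onE_ne_bar := hinv _
  sum_onE {M} _ c hc v l hl := by
    set s : A := ⟨sigma n, hσ⟩
    have key (q : List E) (hq : Γ.IsPath Γ.base q Γ.base) :
        ((q.map (ρ.onE s)).map c).sum = -(q.map c).sum := by
      have h1 : hc.toHom (ρ.onPi1 s (loopClass q hq)) = (hc.toHom (loopClass q hq))⁻¹ := by
        obtain ⟨w, hw⟩ := φ.surjective (loopClass q hq)
        rw [← hw, hρ s w]
        exact hom_sigma (hc.toHom.comp φ.toMonoidHom) w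
      exact h1
    have hcs : Γ.IsCochain (fun e => c (ρ.onE s e)) := fun e => by
      simp only [← ρ.bar_onE]
      exact hc _
    obtain ⟨p, hp⟩ := hΓ v
    have h := key (p ++ (l ++ Γ.revPath p)) (hp.append (hl.append hp.rev))
    simp only [List.map_append, List.sum_append, hc.sum_revPath, List.map_map] at h ⊢
    have h2 : ((Γ.revPath p).map (c ∘ ρ.onE s)).sum = -(p.map (c ∘ ρ.onE s)).sum :=
      hcs.sum_revPath p
    rw [h2] at h
    simpa using h

end PointedGraph

theorem propositionc18 {n : ℕ} (A : Subgroup (MulAut (FreeGroup (Fin n))))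
    (hA : A ≤ palindromicAut n) (hfin : Finite A) (hσ : sigma n ∈ A)
    {V E : Type*} [Finite V] [Finite E] (Γ : PointedGraph V E) (hΓ : Γ.Connected)
    (φ : FreeGroup (Fin n) ≃* Γ.Pi1) (ρ : Γ.Action A) (hρ : Γ.Realizes A φ ρ)
    (hinv : ρ.WithoutInversions) (hred : ρ.IsReduced) :
    (ρ.restrict (Subgroup.zpowers (⟨sigma n, hσ⟩ : A))).IsReduced ∧
      ∃ D : Γ.ThetaOneTree n,
        (∀ v, ρ.onV ⟨sigma n, hσ⟩ v = v) ∧ ∀ e, ρ.onE ⟨sigma n, hσ⟩ e = D.switch e := by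
  have hs := PointedGraph.isHyperelliptic_sigma hσ hΓ hρ hinv
  have hcomm (g : A) : (⟨sigma n, hσ⟩ : A) * g = g * ⟨sigma n, hσ⟩ :=
    Subtype.ext ((palindromic_iff_commute _).1 (hA g.2))
  have hE := hs.onE_ne hred hcomm
  have hV := hs.onV_eq hΓ hred hcomm
  obtain ⟨D, hD⟩ := hs.exists_thetaOneTree hΓ hV hE (hs.card_eq_rank hΓ hV hE φ)
  exact ⟨PointedGraph.Action.isReduced_restrict_zpowers hV hE, D, hV, hD⟩
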